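/- Let $n\ge 0$, $d\ge 1$ and consider $n$ qudits of local dimension $d$, with Hilbert space $(\mathbb C^d)^{\otimes n}$. Write $\|A\|_2=\left(d^{-n}\operatorname{Tr}(A^\dagger A)\right)^{1/2}$ for the normalized Hilbert–Schmidt norm and $\|A\|_\infty$ for the operator norm of an operator $A$; $\log$ is the logarithm to base $2$. For $a=(s_i,t_i)_{i=1}^n\in(\mathbb Z_d\times\mathbb Z_d)^n$ let $P_a=\bigotimes_{i=1}^n X^{s_i}Z^{t_i}$, where $X|j\rangle=|j+1 \bmod d\rangle$ and $Z|j\rangle=e^{2\pi \mathrm i j/d}|j\rangle$. For an operator $O$ with $\|O\|_2=1$ let $P_O[a]=d^{-2n}|\operatorname{Tr}(OP_a)|^2$ and define the quantum Fourier entropy $H[O]=-\sum_a P_O[a]\log P_O[a]$ (with $0\log 0=0$). For a unitary $U$ define the magic power $$\mathcal M[U]=\max_{O:\ \|O\|_2=1}\bigl|H[UOU^\dagger]-H[O]\bigr|.$$ Let $h_1,\dots,h_m$ be traceless Hermitian operators, each acting as the identity outside some set of at most $2$ qudits, with $\|h_j\|_\infty=1$. For $U\in \mathrm{SU}(d^n)$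 the circuit cost with respect to $h_1,\dots,h_m$ is $$\mathrm{Cost}(U)=\inf\int_0^1\sum_{j=1}^m|r_j(s)|\,\mathrm ds\in[0,\infty],$$ where the infimum is over all continuous $r_j:[0,1]\to\mathbb R$ with $U=\mathcal P\exp\left(-\mathrm i\int_0^1 \sum_j r_j(s)h_j\,\mathrm ds\right)$, that is, $U=V(1)$ where $V'(s)=-\mathrm i\sum_j r_j(s)h_j\,V(s)$ on $[0,1]$ and $V(0)=I$ (the infimum is $+\infty$ if there are no such $r_j$). Then, for every $U\in \mathrm{SU}(d^n)$, $$\mathrm{Cost}(U)\ \ge\ \frac{e}{8\,d^2\log e}\,\mathcal M[U].$$ -/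

import Mathlib

noncomputable section

namespace QuditMagic

open Matrix Set

/-- Operators on `n` qudits of local dimension `d`: matrices in the computational basis of
`(ℂ^d)^{⊗ n}`, whose vectors are labelled by `ℤ_d^n`. -/
abbrev Op (n d : ℕ) : Type := Matrix (Fin n → ZMod d) (Fin n → ZMod d) ℂ

variable {n d : ℕ} [NeZero d]

/-- The one-qudit shift operator `X |j⟩ = |j + 1 mod d⟩`. -/
def shiftX (d : ℕ) : Matrix (ZMod d) (ZMod d) ℂ :=
  Matrix.of fun i j => if i = j + 1 then 1 else 0

/-- The one-qudit clock operator `Z |j⟩ = exp (2 π i j / d) |j⟩`. -/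
def clockZ (d : ℕ) : Matrix (ZMod d) (ZMod d) ℂ :=
  Matrix.diagonal fun j => Complex.exp (2 * Real.pi * Complex.I * (j.val : ℂ) / (d : ℂ))

/-- The one-qudit generalized Pauli operator `X^s Z^t` for `a = (s, t)`. -/
def pauliOne (a : ZMod d × ZMod d) : Matrix (ZMod d) (ZMod d) ℂ :=
  shiftX d ^ a.1.val * clockZ d ^ a.2.val

/-- The `n`-qudit generalized Pauli operator `P_a = ⨂ i, X^{s_i} Z^{t_i}`, `a_i = (s_i, t_i)`. -/
def pauli (a : Fin n → ZMod d × ZMod d) : Op n d :=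
  Matrix.of fun x y => ∏ i, pauliOne (a i) (x i) (y i)

/-- The normalized Hilbert-Schmidt inner product `⟨A, B⟩ = d^{-n} Tr (A† B)`. -/
def hsInner (A B : Op n d) : ℂ := (1 / (d : ℂ) ^ n) * (Aᴴ * B).trace

/-- The normalized Hilbert-Schmidt norm `‖A‖₂ = √⟨A, A⟩`. -/
def norm2 (A : Op n d) : ℝ := √ (hsInner A A).re

/-- The Pauli distribution `P_O[a] = d^{-2n} |Tr (O P_a)|²`. -/
def pauliDist (O : Op n d) (a : Fin n → ZMod d × ZMod d) : ℝ :=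
  (1 / (d : ℝ) ^ (2 * n)) * ‖(O * pauli a).trace‖ ^ 2

/-- The quantum Fourier entropy `H[O] = - ∑ a, P_O[a] log₂ P_O[a]` (with `0 log 0 = 0`). -/
def fourierEntropy (O : Op n d) : ℝ :=
  -∑ a, pauliDist O a * Real.logb 2 (pauliDist O a)

/-- The magic power `𝓜[U] = max_{‖O‖₂ = 1} |H[U O U†] - H[O]|`. The maximum is attained, see
`isGreatest_magicPower`. -/
def magicPower (U : Op n d) : ℝ :=
  sSup {x : ℝ | ∃ O : Op n d, norm2 O = 1 ∧ x = |fourierEntropy (U * O * Uᴴ) - fourierEntropy O|}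

/-- `A` is supported on the set `S` of qudits: `A = B ⊗ I` for an operator `B` on the qudits
in `S`, the identity acting on the qudits outside `S`. -/
def SupportedOn (A : Op n d) (S : Finset (Fin n)) : Prop :=
  ∃ B : Matrix (S → ZMod d) (S → ZMod d) ℂ, ∀ x y : Fin n → ZMod d,
    A x y = if ∀ i, i ∉ S → x i = y i then B (fun i => x i) (fun i => y i) else 0

/-- The operator norm `‖A‖_∞` on the Hilbert space `(ℂ^d)^{⊗ n}`. -/
def opNorm (A : Op n d) : ℝ := ‖Matrix.toEuclideanCLM (𝕜 := ℂ) A‖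

/-- `U = 𝒫 exp (-i ∫₀¹ H(s) ds)`: `U` is the value at time `1` of the propagator `V` on `[0, 1]`
given by `V' = -i H V`, `V 0 = 1`. -/
def IsPathOrderedExp (H : ℝ → Op n d) (U : Op n d) : Prop :=
  ∃ V : ℝ → Op n d, V 0 = 1 ∧ V 1 = U ∧
    ∀ s ∈ Icc (0 : ℝ) 1, HasDerivWithinAt V ((-Complex.I) • (H s * V s)) (Icc 0 1) s

/-- The controls admitted in the circuit cost of `U` with respect to `h`: continuous real functions
`r j` on `[0, 1]` with `U = 𝒫 exp (-i ∫₀¹ ∑ j, r j (s) h j ds)`. -/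
def IsControl {m : ℕ} (h : Fin m → Op n d) (U : Op n d) (r : Fin m → ℝ → ℝ) : Prop :=
  (∀ j, ContinuousOn (r j) (Icc 0 1)) ∧
    IsPathOrderedExp (fun s => ∑ j, (r j s : ℂ) • h j) U

/-- The circuit cost of `U` with respect to `h`: the infimum of `∫₀¹ ∑ j, |r j (s)| ds` over all
admitted controls; it is `+∞` if there are none. -/
def circuitCost {m : ℕ} (h : Fin m → Op n d) (U : Op n d) : EReal :=
  ⨅ (r : Fin m → ℝ → ℝ) (_ : IsControl h U r),
    ((∫ s in (0 : ℝ)..1, ∑ j, |r j s| : ℝ) : EReal)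

/-! The maximum in the definition of the magic power is attained. -/

theorem hsInner_self_re (A : Op n d) :
    (hsInner A A).re = (1 / (d : ℝ) ^ n) * ∑ x, ∑ y, ‖A x y‖ ^ 2 := by
  have h : (Aᴴ * A).trace = ((∑ x, ∑ y, ‖A x y‖ ^ 2 : ℝ) : ℂ) := by
    rw [Finset.sum_comm]
    simp only [Matrix.trace, Matrix.diag, Matrix.mul_apply, Matrix.conjTranspose_apply]
    push_cast
    refine Finset.sum_congr rfl fun x _ => Finset.sum_congr rfl fun y _ => ?_
    rw [← Complex.conj_mul']
    rfl
  have h2 : (1 / (d : ℂ) ^ n) = ((1 / (d : ℝ) ^ n : ℝ) : ℂ) := by push_cast; rfl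
  rw [hsInner, h, h2, ← Complex.ofReal_mul, Complex.ofReal_re]

theorem continuous_norm2 : Continuous (norm2 : Op n d → ℝ) := by
  unfold norm2
  simp only [hsInner_self_re]
  fun_prop

theorem continuous_fourierEntropy : Continuous (fourierEntropy : Op n d → ℝ) := by
  have h : (fourierEntropy : Op n d → ℝ) =
      fun O => ∑ a, Real.negMulLog (pauliDist O a) / Real.log 2 := by
    funext O
    simp only [fourierEntropy, Real.negMulLog, Real.logb, ← Finset.sum_neg_distrib]
    refine Finset.sum_congr rfl fun a _ => ?_
    ring
  rw [h]
  refine continuous_finsetSum _ fun a _ => Continuous.div_const ?_ _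
  refine Real.continuous_negMulLog.comp ?_
  unfold pauliDist
  have : Continuous fun O : Op n d => (O * pauli a).trace :=
    (continuous_id.matrix_mul continuous_const).matrix_trace
  fun_prop

theorem isCompact_norm2_eq_one : IsCompact {O : Op n d | norm2 O = 1} := by
  have hK : IsCompact (Set.univ.pi fun _ : Fin n → ZMod d => Set.univ.pi fun _ : Fin n → ZMod d =>
      Metric.closedBall (0 : ℂ) (√((d : ℝ) ^ n))) :=
    isCompact_univ_pi fun _ => isCompact_univ_pi fun _ => isCompact_closedBall _ _
  refine IsCompact.of_isClosed_subset (X := Op n d) hK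
    (isClosed_eq continuous_norm2 continuous_const) ?_
  intro O hO x _ y _
  have hd : (0 : ℝ) < (d : ℝ) ^ n := pow_pos (Nat.cast_pos.2 (NeZero.pos d)) n
  have h1 : (1 / (d : ℝ) ^ n) * ∑ x, ∑ y, ‖O x y‖ ^ 2 = 1 := by
    rw [← hsInner_self_re]
    have h : √ (hsInner O O).re = 1 := hO
    exact Real.sqrt_eq_one.1 h
  have h2 : ∑ x, ∑ y, ‖O x y‖ ^ 2 = (d : ℝ) ^ n := by
    field_simp at h1
    exact h1
  rw [mem_closedBall_zero_iff]
  refine Real.le_sqrt_of_sq_le ?_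
  rw [← h2]
  calc ‖O x y‖ ^ 2 ≤ ∑ y, ‖O x y‖ ^ 2 :=
        Finset.single_le_sum (f := fun y => ‖O x y‖ ^ 2) (fun _ _ => by positivity)
          (Finset.mem_univ y)
    _ ≤ _ := Finset.single_le_sum (f := fun x => ∑ y, ‖O x y‖ ^ 2) (fun _ _ => by positivity)
          (Finset.mem_univ x)

theorem norm2_one : norm2 (1 : Op n d) = 1 := by
  have hd : (d : ℂ) ≠ 0 := Nat.cast_ne_zero.2 (NeZero.ne d)
  simp [norm2, hsInner, Matrix.trace_one, hd]

theorem isGreatest_magicPower (U : Op n d) :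
    IsGreatest {x : ℝ | ∃ O : Op n d, norm2 O = 1 ∧
      x = |fourierEntropy (U * O * Uᴴ) - fourierEntropy O|} (magicPower U) := by
  have hc : Continuous fun O : Op n d => |fourierEntropy (U * O * Uᴴ) - fourierEntropy O| := by
    have h : Continuous fun O : Op n d => U * O * Uᴴ :=
      (continuous_const.matrix_mul continuous_id).matrix_mul continuous_const
    exact ((continuous_fourierEntropy.comp h).sub continuous_fourierEntropy).abs
  have he : {x : ℝ | ∃ O : Op n d, norm2 O = 1 ∧
      x = |fourierEntropy (U * O * Uᴴ) - fourierEntropy O|} =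
      (fun O : Op n d => |fourierEntropy (U * O * Uᴴ) - fourierEntropy O|) ''
        {O : Op n d | norm2 O = 1} := by
    ext x
    simp only [Set.mem_ofPred_eq, Set.mem_image, eq_comm]
  unfold magicPower
  rw [he]
  exact (isCompact_norm2_eq_one.image hc).isGreatest_sSup ⟨_, 1, norm2_one, rfl⟩

end QuditMagic

end

/-! The entropy of `V(s) O V(s)†` changes along a controlled evolution at rate at most
`(8 d² / e) ∑ j, |r j (s)|` (in natural units); integrating over `[0, 1]` and taking for `O` an
operator that attains the magic power gives the bound.

With `c_a` the Pauli coefficients of the evolved operator, the rate is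
`-2 ∑ a, Re (c̄_a c'_a) log |c_a|²`, where `c'` are the coefficients of `-i [H, ·]`
(`hasDerivWithinAt_negMulLog_norm_sq`; no singularity arises where `c_a` vanishes). It is linear in
`H`, so one generator `A = B ⊗ 1` supported on at most two qudits can be treated at a time. Taking
the partial trace against a Pauli operator outside the support turns `[A, ·]` into `[B, ·]`, hence
the coefficients split into blocks of at most `d ^ 4` elements that evolve independently, each with
conserved weight `w`. In a block, the coefficients may be rescaled to a unit vector; then
`x |log x| ≤ 1 / e`, the Cauchy-Schwarz inequality and `‖[B, Q]‖₂ ≤ 2 ‖Q‖₂` bound its part of the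
rate by `(8 d² / e) w` (`abs_sum_re_mul_log_le`, `abs_sum_pauliTrace_commutator_mul_log_le`). The
weights sum to `1` by Parseval's identity (`sum_conj_pauliTrace_mul`).
-/

noncomputable section

namespace QuditMagic

open Matrix Set
open scoped ComplexConjugate

/-! ### The entropy of a curve of amplitudes -/

theorem negMulLog_norm_sq_isLittleO :
    (fun z : ℂ => Real.negMulLog (‖z‖ ^ 2)) =o[nhds 0] (fun z : ℂ => z) := by
  have h1 : (fun z : ℂ => Real.negMulLog (‖z‖ ^ 2)) =
      fun z => ‖z‖ * (2 * Real.negMulLog ‖z‖) := by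
    funext z
    simp only [Real.negMulLog, Real.log_pow]
    push_cast
    ring
  have h2 : (fun z : ℂ => 2 * Real.negMulLog ‖z‖) =o[nhds 0] (fun _ : ℂ => (1 : ℝ)) := by
    rw [Asymptotics.isLittleO_one_iff]
    have hc : Continuous fun z : ℂ => 2 * Real.negMulLog ‖z‖ := by fun_prop
    simpa using hc.tendsto 0
  rw [h1]
  have h3 := (Asymptotics.isBigO_refl (fun z : ℂ => ‖z‖) (nhds 0)).mul_isLittleO h2
  simp only [mul_one] at h3
  exact h3.of_norm_right

/-- `-|z|² log |z|²` is differentiable along every differentiable curve, even through `z = 0`: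
there it is `o(|z|)`, and the formula gives the right value `0`. -/
theorem hasDerivWithinAt_negMulLog_norm_sq {z : ℝ → ℂ} {z' : ℂ} {s : Set ℝ} {t : ℝ}
    (hz : HasDerivWithinAt z z' s t) :
    HasDerivWithinAt (fun u => Real.negMulLog (‖z u‖ ^ 2))
      (-(2 * (conj (z t) * z').re) * (Real.log (‖z t‖ ^ 2) + 1)) s t := by
  by_cases h0 : z t = 0
  · have h1 : HasFDerivAt (fun w : ℂ => Real.negMulLog (‖w‖ ^ 2)) (0 : ℂ →L[ℝ] ℝ) (z t) := by
      rw [h0, hasFDerivAt_iff_isLittleO]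
      simpa using negMulLog_norm_sq_isLittleO
    have h2 := h1.comp_hasDerivWithinAt t hz
    simpa [h0, Function.comp_def] using h2
  · have h1 : ‖z t‖ ^ 2 ≠ 0 := by simpa using h0
    have h2 := (Real.hasDerivAt_negMulLog h1).comp_hasDerivWithinAt t hz.norm_sq
    refine h2.congr_deriv ?_
    rw [Complex.inner, mul_comm z']
    ring

theorem abs_mul_log_le {x : ℝ} (h0 : 0 ≤ x) (h1 : x ≤ 1) :
    x * |Real.log x| ≤ (Real.exp 1)⁻¹ := by
  rcases h0.eq_or_lt with rfl | hx
  · simpa using (Real.exp_pos 1).le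
  · rw [abs_of_nonpos (Real.log_nonpos h0 h1)]
    have h2 := Real.add_one_le_exp (-Real.log x - 1)
    rw [Real.exp_sub, Real.exp_neg, Real.exp_log hx] at h2
    have h3 := mul_le_mul_of_nonneg_left h2 h0
    calc x * -Real.log x = x * (-Real.log x - 1 + 1) := by ring
      _ ≤ x * (x⁻¹ / Real.exp 1) := h3
      _ = (Real.exp 1)⁻¹ := by field_simp

/-- The amplitudes are rescaled to a unit vector, which the conservation law `∑ Re (z̄ z') = 0`
permits; then `x |log x| ≤ 1/e` and the Cauchy-Schwarz inequality give the bound. -/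
theorem abs_sum_re_mul_log_le {ι : Type*} [Fintype ι] (z z' : ι → ℂ)
    (h0 : ∑ i, (conj (z i) * z' i).re = 0)
    (h1 : ∑ i, ‖z' i‖ ^ 2 ≤ 4 * ∑ i, ‖z i‖ ^ 2) :
    |∑ i, (conj (z i) * z' i).re * Real.log (‖z i‖ ^ 2)| ≤
      4 * √(Fintype.card ι) * (Real.exp 1)⁻¹ * ∑ i, ‖z i‖ ^ 2 := by
  set w := ∑ i, ‖z i‖ ^ 2 with hw
  have hw0 : 0 ≤ w := Finset.sum_nonneg fun _ _ => by positivity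
  have hle : ∀ i, ‖z i‖ ≤ √w := fun i => Real.le_sqrt_of_sq_le
    (Finset.single_le_sum (f := fun i => ‖z i‖ ^ 2) (fun _ _ => by positivity)
      (Finset.mem_univ i))
  have hterm : ∀ i, |(conj (z i) * z' i).re * (Real.log (‖z i‖ ^ 2) - Real.log w)| ≤
      2 * (Real.exp 1)⁻¹ * √w * ‖z' i‖ := by
    intro i
    by_cases hz : z i = 0
    · simp only [hz, map_zero, zero_mul, Complex.zero_re, abs_zero]
      positivity
    have hzn : 0 < ‖z i‖ := norm_pos_iff.2 hz
    have hsw : 0 < √w := hzn.trans_le (hle i)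
    have hlog : Real.log (‖z i‖ ^ 2) - Real.log w = 2 * Real.log (‖z i‖ / √w) := by
      rw [Real.log_div hzn.ne' hsw.ne', Real.log_sqrt hw0, Real.log_pow]
      push_cast
      ring
    have h2 := abs_mul_log_le (x := ‖z i‖ / √w) (by positivity) ((div_le_one hsw).2 (hle i))
    have h3 : |(conj (z i) * z' i).re| ≤ ‖z i‖ * ‖z' i‖ := by
      refine (Complex.abs_re_le_norm _).trans ?_
      rw [norm_mul, Complex.norm_conj]
    rw [hlog, abs_mul, abs_mul, abs_two]
    calc _ ≤ (‖z i‖ * ‖z' i‖) * (2 * |Real.log (‖z i‖ / √w)|) := by gcongr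
      _ = 2 * √w * ‖z' i‖ * (‖z i‖ / √w * |Real.log (‖z i‖ / √w)|) := by
        field_simp
      _ ≤ 2 * √w * ‖z' i‖ * (Real.exp 1)⁻¹ := by gcongr
      _ = _ := by ring
  have hsub : ∑ i, (conj (z i) * z' i).re * Real.log (‖z i‖ ^ 2) =
      ∑ i, (conj (z i) * z' i).re * (Real.log (‖z i‖ ^ 2) - Real.log w) := by
    simp only [mul_sub, Finset.sum_sub_distrib, ← Finset.sum_mul, h0]
    rw [zero_mul, sub_zero]
  have hcs : ∑ i, ‖z' i‖ ≤ √(Fintype.card ι) * (2 * √w) := by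
    have h2 := sq_sum_le_card_mul_sum_sq (s := Finset.univ) (f := fun i => ‖z' i‖)
    rw [Finset.card_univ] at h2
    have h4 : (∑ i, ‖z' i‖) ^ 2 ≤ (√(Fintype.card ι) * (2 * √w)) ^ 2 := by
      rw [mul_pow, mul_pow, Real.sq_sqrt hw0, Real.sq_sqrt (Nat.cast_nonneg _)]
      refine h2.trans ?_
      gcongr
      linarith
    exact (sq_le_sq₀ (Finset.sum_nonneg fun _ _ => norm_nonneg _) (by positivity)).1 h4
  rw [hsub]
  calc _ ≤ ∑ i, 2 * (Real.exp 1)⁻¹ * √w * ‖z' i‖ :=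
        (Finset.abs_sum_le_sum_abs _ _).trans (Finset.sum_le_sum fun i _ => hterm i)
    _ = 2 * (Real.exp 1)⁻¹ * √w * ∑ i, ‖z' i‖ := by rw [Finset.mul_sum]
    _ ≤ 2 * (Real.exp 1)⁻¹ * √w * (√(Fintype.card ι) * (2 * √w)) := by gcongr
    _ = 4 * √(Fintype.card ι) * (Real.exp 1)⁻¹ * (√w * √w) := by ring
    _ = _ := by rw [Real.mul_self_sqrt hw0]

/-! ### Parseval's identity for the generalized Pauli operators -/

variable {n d : ℕ} [NeZero d]

theorem shiftX_pow_apply (k : ℕ) (i j : ZMod d) :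
    (shiftX d ^ k) i j = if i = j + k then 1 else 0 := by
  induction k generalizing i j with
  | zero => simp [Matrix.one_apply]
  | succ k ih =>
    rw [pow_succ, Matrix.mul_apply]
    have h : ∀ l, shiftX d l j = if l = j + 1 then 1 else 0 := fun l => rfl
    simp only [h, mul_ite, mul_one, mul_zero, Finset.sum_ite_eq', Finset.mem_univ, if_true, ih]
    rw [Nat.cast_succ, add_assoc, add_comm (1 : ZMod d)]

theorem pauliOne_apply (a : ZMod d × ZMod d) (i j : ZMod d) :
    pauliOne a i j = if i = j + a.1 then ZMod.stdAddChar (a.2 * j) else 0 := by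
  have h : ∀ j : ZMod d, Complex.exp (2 * Real.pi * Complex.I * (j.val : ℂ) / (d : ℂ)) =
      ZMod.stdAddChar j := fun j => by rw [ZMod.stdAddChar_apply, ZMod.toCircle_apply]
  have h2 : ZMod.stdAddChar j ^ a.2.val = ZMod.stdAddChar (a.2 * j) := by
    rw [← AddChar.map_nsmul_eq_pow, nsmul_eq_mul, ZMod.natCast_zmod_val]
  rw [pauliOne, clockZ, Matrix.diagonal_pow, Matrix.mul_diagonal, shiftX_pow_apply, Pi.pow_apply,
    h, h2, ZMod.natCast_zmod_val, ite_mul, one_mul, zero_mul]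

/-- The completeness relation of the one-qudit Pauli operators. -/
theorem sum_conj_pauliOne_mul (x y x' y' : ZMod d) :
    ∑ a, conj (pauliOne a x y) * pauliOne a x' y' = if x = x' ∧ y = y' then (d : ℂ) else 0 := by
  have hchar : ∀ t : ZMod d, conj (ZMod.stdAddChar (t * y)) * ZMod.stdAddChar (t * y') =
      (ZMod.stdAddChar (t * (y' - y)) : ℂ) := by
    intro t
    rw [← AddChar.map_neg_eq_conj, ← AddChar.map_add_eq_mul]
    congr 1
    ring
  have hsum : ∑ t : ZMod d, (ZMod.stdAddChar (t * (y' - y)) : ℂ) =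
      if y = y' then (d : ℂ) else 0 := by
    rw [AddChar.sum_mulShift _ (ZMod.isPrimitive_stdAddChar d), ZMod.card]
    simp only [sub_eq_zero, eq_comm (a := y'), Nat.cast_ite, Nat.cast_zero]
  rw [Fintype.sum_prod_type]
  have hs : ∀ s : ZMod d, ∑ t, conj (pauliOne (s, t) x y) * pauliOne (s, t) x' y' =
      if x = y + s then (if x' = y' + s then (if y = y' then (d : ℂ) else 0) else 0) else 0 := by
    intro s
    simp only [pauliOne_apply]
    split_ifs with h1 h2 h3 <;> simp_all
  simp only [hs]
  have : ∀ s : ZMod d, (x = y + s) = (s = x - y) := fun s => by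
    rw [eq_sub_iff_add_eq, add_comm s y, eq_comm (a := x)]
  simp only [this, Finset.sum_ite_eq', Finset.mem_univ, if_true]
  by_cases h : y = y' <;> simp [h, eq_comm]

section

variable {ι : Type*} [Fintype ι] [DecidableEq ι]

/-- The trace of `A P_a`, for a finite set `ι` of qudits. -/
def pauliTrace (A : Matrix (ι → ZMod d) (ι → ZMod d) ℂ) (a : ι → ZMod d × ZMod d) : ℂ :=
  ∑ x, ∑ y, A x y * ∏ i, pauliOne (a i) (y i) (x i)

theorem sum_conj_prod_pauliOne_mul (x y x' y' : ι → ZMod d) :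
    ∑ a : ι → ZMod d × ZMod d,
      conj (∏ i, pauliOne (a i) (x i) (y i)) * ∏ i, pauliOne (a i) (x' i) (y' i) =
      if x = x' ∧ y = y' then (d : ℂ) ^ Fintype.card ι else 0 := by
  have h := Finset.sum_prod_piFinset (ι := ι) (Finset.univ : Finset (ZMod d × ZMod d))
    (fun i a => conj (pauliOne a (x i) (y i)) * pauliOne a (x' i) (y' i))
  rw [Fintype.piFinset_univ] at h
  simp only [map_prod, ← Finset.prod_mul_distrib, h, sum_conj_pauliOne_mul]
  by_cases hxy : x = x' ∧ y = y'
  · simp [hxy.1, hxy.2]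
  · rw [if_neg hxy]
    have : ∃ i, ¬(x i = x' i ∧ y i = y' i) := by
      by_contra! hc
      exact hxy ⟨funext fun i => (hc i).1, funext fun i => (hc i).2⟩
    obtain ⟨i, hi⟩ := this
    exact Finset.prod_eq_zero (Finset.mem_univ i) (if_neg hi)

/-- Parseval's identity for the Pauli expansion. -/
theorem sum_conj_pauliTrace_mul (A B : Matrix (ι → ZMod d) (ι → ZMod d) ℂ) :
    ∑ a, conj (pauliTrace A a) * pauliTrace B a =
      (d : ℂ) ^ Fintype.card ι * (Aᴴ * B).trace := by
  have h1 : ∀ a : ι → ZMod d × ZMod d, conj (pauliTrace A a) * pauliTrace B a =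
      ∑ x, ∑ y, ∑ x', ∑ y', conj (A x y) * B x' y' *
        (conj (∏ i, pauliOne (a i) (y i) (x i)) * ∏ i, pauliOne (a i) (y' i) (x' i)) := by
    intro a
    simp only [pauliTrace, map_sum, map_mul]
    rw [Finset.sum_mul]
    refine Finset.sum_congr rfl fun x _ => ?_
    rw [Finset.sum_mul]
    refine Finset.sum_congr rfl fun y _ => ?_
    rw [Finset.mul_sum]
    refine Finset.sum_congr rfl fun x' _ => ?_
    rw [Finset.mul_sum]
    refine Finset.sum_congr rfl fun y' _ => ?_
    ring
  have h2 : (Aᴴ * B).trace = ∑ x, ∑ y, conj (A x y) * B x y := by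
    rw [Finset.sum_comm]
    rfl
  simp only [h1]
  rw [Finset.sum_comm, h2, Finset.mul_sum]
  refine Finset.sum_congr rfl fun x _ => ?_
  rw [Finset.sum_comm, Finset.mul_sum]
  refine Finset.sum_congr rfl fun y _ => ?_
  rw [Finset.sum_comm, Finset.sum_eq_single x]
  · rw [Finset.sum_comm, Finset.sum_eq_single y]
    · rw [← Finset.mul_sum, sum_conj_prod_pauliOne_mul]
      simp only [and_self, if_true]
      ring
    · intro y' _ hy
      rw [← Finset.mul_sum, sum_conj_prod_pauliOne_mul, if_neg (fun h => hy h.1.symm), mul_zero]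
    · simp
  · intro x' _ hx
    rw [Finset.sum_comm]
    refine Finset.sum_eq_zero fun y' _ => ?_
    rw [← Finset.mul_sum, sum_conj_prod_pauliOne_mul, if_neg (fun h => hx h.2.symm), mul_zero]
  · simp

theorem sum_norm_sq_pauliTrace (A : Matrix (ι → ZMod d) (ι → ZMod d) ℂ) :
    ∑ a, ‖pauliTrace A a‖ ^ 2 = (d : ℝ) ^ Fintype.card ι * ∑ x, ∑ y, ‖A x y‖ ^ 2 := by
  have h := sum_conj_pauliTrace_mul A A
  have h2 : (Aᴴ * A).trace = ∑ x, ∑ y, conj (A x y) * A x y := by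
    rw [Finset.sum_comm]
    rfl
  rw [h2] at h
  simp only [Complex.conj_mul'] at h
  exact_mod_cast h

end

theorem trace_mul_pauli (O : Op n d) (a : Fin n → ZMod d × ZMod d) :
    (O * pauli a).trace = pauliTrace O a := by
  simp only [Matrix.trace, Matrix.diag, Matrix.mul_apply, pauli, Matrix.of_apply, pauliTrace]

/-! ### Commutators with local operators -/

theorem sum_norm_sq_mulVec_le {A : Op n d} (hA : opNorm A ≤ 1) (v : (Fin n → ZMod d) → ℂ) :
    ∑ x, ‖(A *ᵥ v) x‖ ^ 2 ≤ ∑ x, ‖v x‖ ^ 2 := by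
  have h := (Matrix.toEuclideanCLM (𝕜 := ℂ) A).le_of_opNorm_le hA (WithLp.toLp 2 v)
  rw [one_mul] at h
  have h2 := pow_le_pow_left₀ (norm_nonneg _) h 2
  rw [EuclideanSpace.norm_sq_eq, EuclideanSpace.norm_sq_eq] at h2
  exact h2

section Contraction

variable {α : Type*} [Fintype α] {B : Matrix α α ℂ}

theorem sum_norm_sq_mul_le (hB : ∀ v : α → ℂ, ∑ x, ‖(B *ᵥ v) x‖ ^ 2 ≤ ∑ x, ‖v x‖ ^ 2)
    (Q : Matrix α α ℂ) : ∑ x, ∑ y, ‖(B * Q) x y‖ ^ 2 ≤ ∑ x, ∑ y, ‖Q x y‖ ^ 2 := by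
  rw [Finset.sum_comm, Finset.sum_comm (f := fun x y => ‖Q x y‖ ^ 2)]
  exact Finset.sum_le_sum fun y _ => hB (fun x => Q x y)

/-- A commutator with a Hermitian contraction at most doubles the Hilbert-Schmidt norm. -/
theorem sum_norm_sq_commutator_le (hH : B.IsHermitian)
    (hB : ∀ v : α → ℂ, ∑ x, ‖(B *ᵥ v) x‖ ^ 2 ≤ ∑ x, ‖v x‖ ^ 2) (Q : Matrix α α ℂ) :
    ∑ x, ∑ y, ‖((-Complex.I) • (B * Q - Q * B)) x y‖ ^ 2 ≤ 4 * ∑ x, ∑ y, ‖Q x y‖ ^ 2 := by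
  have hct : ∀ M : Matrix α α ℂ, ∑ x, ∑ y, ‖Mᴴ x y‖ ^ 2 = ∑ x, ∑ y, ‖M x y‖ ^ 2 := by
    intro M
    rw [Finset.sum_comm]
    simp only [Matrix.conjTranspose_apply, norm_star]
  have h1 := sum_norm_sq_mul_le hB Q
  have h2 : ∑ x, ∑ y, ‖(Q * B) x y‖ ^ 2 ≤ ∑ x, ∑ y, ‖Q x y‖ ^ 2 := by
    rw [← hct, ← hct Q, Matrix.conjTranspose_mul, hH.eq]
    exact sum_norm_sq_mul_le hB Qᴴ
  calc _ ≤ ∑ x, ∑ y, (2 * ‖(B * Q) x y‖ ^ 2 + 2 * ‖(Q * B) x y‖ ^ 2) := by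
        refine Finset.sum_le_sum fun x _ => Finset.sum_le_sum fun y _ => ?_
        rw [Matrix.smul_apply, smul_eq_mul, norm_mul, norm_neg, Complex.norm_I, one_mul,
          Matrix.sub_apply]
        have h3 := norm_sub_le ((B * Q) x y) ((Q * B) x y)
        have h4 := pow_le_pow_left₀ (norm_nonneg _) h3 2
        nlinarith [sq_nonneg (‖(B * Q) x y‖ - ‖(Q * B) x y‖)]
    _ = 2 * ∑ x, ∑ y, ‖(B * Q) x y‖ ^ 2 + 2 * ∑ x, ∑ y, ‖(Q * B) x y‖ ^ 2 := by
        simp only [Finset.sum_add_distrib, Finset.mul_sum]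
    _ ≤ _ := by linarith

theorem re_trace_conjTranspose_mul_commutator (hH : B.IsHermitian) (Q : Matrix α α ℂ) :
    (Qᴴ * ((-Complex.I) • (B * Q - Q * B))).trace.re = 0 := by
  have hreal : ∀ M : Matrix α α ℂ, M.IsHermitian → M.trace.im = 0 := by
    intro M hM
    have h : star M.trace = M.trace := by rw [← Matrix.trace_conjTranspose, hM.eq]
    exact Complex.conj_eq_iff_im.1 h
  have h1 : (Qᴴ * (B * Q)).IsHermitian := by
    rw [Matrix.IsHermitian, Matrix.conjTranspose_mul, Matrix.conjTranspose_mul, hH.eq,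
      Matrix.conjTranspose_conjTranspose, Matrix.mul_assoc]
  have h2 : (Q * B * Qᴴ).IsHermitian := by
    rw [Matrix.IsHermitian, Matrix.conjTranspose_mul, Matrix.conjTranspose_mul, hH.eq,
      Matrix.conjTranspose_conjTranspose, Matrix.mul_assoc]
  rw [Matrix.mul_smul, Matrix.trace_smul, Matrix.mul_sub, Matrix.trace_sub,
    Matrix.trace_mul_comm Qᴴ (Q * B), smul_eq_mul, Complex.mul_re, Complex.sub_im, hreal _ h1,
    hreal _ h2]
  simp

end Contraction

/-- The configuration that is `u` on the qudits in `S` and `v` on the others. -/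
abbrev glue {γ : Type*} (S : Finset (Fin n)) :
    ((S → γ) × ({i // i ∉ S} → γ)) ≃ (Fin n → γ) :=
  (Equiv.piEquivPiSubtypeProd (· ∈ S) (fun _ => γ)).symm

/-- The partial trace of `O (1 ⊗ P_κ)` over the qudits outside `S`. -/
def partialPauliTrace (S : Finset (Fin n)) (κ : {i // i ∉ S} → ZMod d × ZMod d) (O : Op n d) :
    Matrix (S → ZMod d) (S → ZMod d) ℂ :=
  Matrix.of fun u u' => ∑ v, ∑ v', O (glue S (u, v)) (glue S (u', v')) *
    ∏ i, pauliOne (κ i) (v' i) (v i)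

theorem pauliTrace_partialPauliTrace (S : Finset (Fin n)) (κ : {i // i ∉ S} → ZMod d × ZMod d)
    (O : Op n d) (a : S → ZMod d × ZMod d) :
    pauliTrace (partialPauliTrace S κ O) a = pauliTrace O (glue S (a, κ)) := by
  have hprod : ∀ u v u' v', ∏ i, pauliOne (glue S (a, κ) i) (glue S (u', v') i) (glue S (u, v) i) =
      (∏ i, pauliOne (a i) (u' i) (u i)) *
        ∏ i, pauliOne (κ i) (v' i) ((v : {i // i ∉ S} → ZMod d) i) := by
    intro u v u' v'
    rw [← Fintype.prod_subtype_mul_prod_subtype (· ∈ S)]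
    congr 1
    · refine Finset.prod_congr (by ext i; simp) fun i _ => ?_
      simp [glue, Equiv.piEquivPiSubtypeProd, i.2]
    · refine Finset.prod_congr (by ext i; simp) fun i _ => ?_
      simp [glue, Equiv.piEquivPiSubtypeProd, i.2]
  have h : pauliTrace O (glue S (a, κ)) = ∑ u, ∑ v, ∑ u', ∑ v',
      O (glue S (u, v)) (glue S (u', v')) *
        ∏ i, pauliOne (glue S (a, κ) i) (glue S (u', v') i) (glue S (u, v) i) := by
    rw [pauliTrace, ← (glue S).sum_comp, Fintype.sum_prod_type]
    refine Finset.sum_congr rfl fun u _ => Finset.sum_congr rfl fun v _ => ?_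
    rw [← (glue S).sum_comp, Fintype.sum_prod_type]
  rw [h, pauliTrace]
  refine Finset.sum_congr rfl fun u _ => ?_
  rw [Finset.sum_comm]
  refine Finset.sum_congr rfl fun u' _ => ?_
  simp only [partialPauliTrace, Matrix.of_apply, Finset.sum_mul, hprod]
  refine Finset.sum_congr rfl fun v _ => Finset.sum_congr rfl fun v' _ => ?_
  ring

/-- `A = B ⊗ 1`, with `B` acting on the qudits in `S`. -/
def IsTensorOne (S : Finset (Fin n)) (B : Matrix (S → ZMod d) (S → ZMod d) ℂ) (A : Op n d) : Prop :=
  ∀ u v u' v', A (glue S (u, v)) (glue S (u', v')) = if v = v' then B u u' else 0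

omit [NeZero d] in
theorem SupportedOn.exists_isTensorOne {A : Op n d} {S : Finset (Fin n)} (hA : SupportedOn A S) :
    ∃ B, IsTensorOne S B A := by
  obtain ⟨B, hB⟩ := hA
  refine ⟨B, fun u v u' v' => ?_⟩
  rw [hB]
  have h1 : (∀ i, i ∉ S → glue S (u, v) i = glue S (u', v') i) ↔ v = v' := by
    constructor
    · intro h
      funext i
      simpa [glue, Equiv.piEquivPiSubtypeProd, i.2] using h i i.2
    · rintro rfl i hi
      simp [glue, Equiv.piEquivPiSubtypeProd, hi]
  have h2 : ∀ (u : S → ZMod d) v, (fun i : S => glue S (u, v) i) = u := by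
    intro u v
    funext i
    simp [glue, Equiv.piEquivPiSubtypeProd, i.2]
  simp only [h1, h2]

namespace IsTensorOne

variable {S : Finset (Fin n)} {B : Matrix (S → ZMod d) (S → ZMod d) ℂ} {A : Op n d}

omit [NeZero d] in
theorem isHermitian (h : IsTensorOne S B A) (hA : A.IsHermitian) : B.IsHermitian := by
  ext u u'
  have h1 := h u' 0 u 0
  have h2 := h u 0 u' 0
  rw [if_pos rfl] at h1 h2
  rw [Matrix.conjTranspose_apply, ← h1, ← h2, hA.apply]

theorem sum_norm_sq_mulVec_le (h : IsTensorOne S B A) (hA : opNorm A ≤ 1)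
    (w : (S → ZMod d) → ℂ) : ∑ u, ‖(B *ᵥ w) u‖ ^ 2 ≤ ∑ u, ‖w u‖ ^ 2 := by
  -- The vector `w ⊗ |0⟩`, which `A` maps to `B w ⊗ |0⟩`.
  let W : (Fin n → ZMod d) → ℂ := fun x =>
    if ((glue S).symm x).2 = 0 then w ((glue S).symm x).1 else 0
  have hW : ∀ u v, W (glue S (u, v)) = if v = 0 then w u else 0 := fun u v => by
    simp only [W, Equiv.symm_apply_apply]
  have hAW : ∀ u v, (A *ᵥ W) (glue S (u, v)) = if v = 0 then (B *ᵥ w) u else 0 := by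
    intro u v
    rw [Matrix.mulVec, dotProduct, ← (glue S).sum_comp, Fintype.sum_prod_type]
    simp only [h u v, hW, mul_ite, ite_mul, zero_mul, mul_zero, Finset.sum_ite_eq',
      Finset.mem_univ, if_true]
    split_ifs <;> simp [Matrix.mulVec, dotProduct]
  have h1 := QuditMagic.sum_norm_sq_mulVec_le hA W
  rw [← (glue S).sum_comp, ← (glue S).sum_comp (fun x => ‖W x‖ ^ 2), Fintype.sum_prod_type,
    Fintype.sum_prod_type] at h1
  have h2 : ∀ (f : (S → ZMod d) → ℂ), ∑ u, ∑ v : {i // i ∉ S} → ZMod d,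
      ‖if v = 0 then f u else 0‖ ^ 2 = ∑ u, ‖f u‖ ^ 2 := by
    intro f
    refine Finset.sum_congr rfl fun u _ => ?_
    rw [Finset.sum_eq_single 0]
    · simp
    · intro v _ hv
      simp [hv]
    · simp
  simp only [hAW, hW] at h1
  rwa [h2, h2] at h1

theorem partialPauliTrace_mul_left (h : IsTensorOne S B A)
    (κ : {i // i ∉ S} → ZMod d × ZMod d) (O : Op n d) :
    partialPauliTrace S κ (A * O) = B * partialPauliTrace S κ O := by
  ext u u'
  simp only [partialPauliTrace, Matrix.of_apply, Matrix.mul_apply]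
  have h1 : ∀ v y, ∑ x, A (glue S (u, v)) x * O x y = ∑ u₁, B u u₁ * O (glue S (u₁, v)) y := by
    intro v y
    rw [← (glue S).sum_comp, Fintype.sum_prod_type]
    simp only [h u v, ite_mul, zero_mul, Finset.sum_ite_eq, Finset.mem_univ, if_true]
  simp only [h1, Finset.mul_sum, Finset.sum_mul]
  refine (Finset.sum_congr rfl fun v _ => Finset.sum_comm).trans ?_
  rw [Finset.sum_comm]
  refine Finset.sum_congr rfl fun u₁ _ => Finset.sum_congr rfl fun v _ =>
    Finset.sum_congr rfl fun v' _ => ?_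
  ring

theorem partialPauliTrace_mul_right (h : IsTensorOne S B A)
    (κ : {i // i ∉ S} → ZMod d × ZMod d) (O : Op n d) :
    partialPauliTrace S κ (O * A) = partialPauliTrace S κ O * B := by
  ext u u'
  simp only [partialPauliTrace, Matrix.of_apply, Matrix.mul_apply]
  have h1 : ∀ v' y, ∑ x, O y x * A x (glue S (u', v')) = ∑ u₁, O y (glue S (u₁, v')) * B u₁ u' := by
    intro v y
    rw [← (glue S).sum_comp, Fintype.sum_prod_type]
    simp only [h _ _ u' v, mul_ite, mul_zero, Finset.sum_ite_eq', Finset.mem_univ, if_true]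
  simp only [h1, Finset.sum_mul]
  refine (Finset.sum_congr rfl fun v _ => Finset.sum_comm).trans ?_
  rw [Finset.sum_comm]
  refine Finset.sum_congr rfl fun u₁ _ => Finset.sum_congr rfl fun v _ =>
    Finset.sum_congr rfl fun v' _ => ?_
  ring

end IsTensorOne

theorem partialPauliTrace_smul_sub (S : Finset (Fin n)) (κ : {i // i ∉ S} → ZMod d × ZMod d)
    (c : ℂ) (O O' : Op n d) : partialPauliTrace S κ (c • (O - O')) =
      c • (partialPauliTrace S κ O - partialPauliTrace S κ O') := by
  ext u u'
  simp only [partialPauliTrace, Matrix.of_apply, Matrix.smul_apply, Matrix.sub_apply, smul_eq_mul,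
    sub_mul, mul_sub, Finset.sum_sub_distrib, Finset.mul_sum, mul_assoc]

theorem sum_re_conj_pauliTrace_commutator {A : Op n d} (hA : A.IsHermitian) (O : Op n d) :
    ∑ a, (conj (pauliTrace O a) * pauliTrace ((-Complex.I) • (A * O - O * A)) a).re = 0 := by
  rw [← Complex.re_sum, sum_conj_pauliTrace_mul, ← Nat.cast_pow, ← Complex.ofReal_natCast,
    Complex.re_ofReal_mul, re_trace_conjTranspose_mul_commutator hA, mul_zero]

/-- The infinitesimal entropy bound. Commutation with `A = B ⊗ 1` acts on the Pauli coefficients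
with a fixed part `κ` outside `S` as commutation with `B`, so it conserves the weight of each of
these blocks, which has only `d ^ (2 |S|) ≤ d ^ 4` elements. -/
theorem abs_sum_pauliTrace_commutator_mul_log_le {A : Op n d} (hA : A.IsHermitian)
    {S : Finset (Fin n)} (hS : S.card ≤ 2) (hAS : SupportedOn A S) (hn : opNorm A ≤ 1)
    (O : Op n d) :
    |∑ a, (conj (pauliTrace O a) * pauliTrace ((-Complex.I) • (A * O - O * A)) a).re *
        Real.log (‖pauliTrace O a‖ ^ 2)| ≤
      4 * (d : ℝ) ^ 2 * (Real.exp 1)⁻¹ * ∑ a, ‖pauliTrace O a‖ ^ 2 := by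
  obtain ⟨B, hB⟩ := hAS.exists_isTensorOne
  have hBh := hB.isHermitian hA
  have hcard : √(Fintype.card (S → ZMod d × ZMod d)) ≤ (d : ℝ) ^ 2 := by
    refine Real.sqrt_le_iff.2 ⟨by positivity, ?_⟩
    rw [Fintype.card_fun, Fintype.card_prod, ZMod.card, Fintype.card_coe]
    have h1 : (1 : ℝ) ≤ (d : ℝ) * d := by
      have : (1 : ℝ) ≤ d := Nat.one_le_cast.2 (NeZero.pos d)
      nlinarith
    calc (((d * d) ^ S.card : ℕ) : ℝ) = ((d : ℝ) * d) ^ S.card := by push_cast; rfl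
      _ ≤ ((d : ℝ) * d) ^ 2 := pow_le_pow_right₀ h1 hS
      _ = ((d : ℝ) ^ 2) ^ 2 := by ring
  have hcomm : ∀ κ, partialPauliTrace S κ ((-Complex.I) • (A * O - O * A)) =
      (-Complex.I) • (B * partialPauliTrace S κ O - partialPauliTrace S κ O * B) := by
    intro κ
    rw [partialPauliTrace_smul_sub, hB.partialPauliTrace_mul_left, hB.partialPauliTrace_mul_right]
  have hblock : ∀ κ : {i // i ∉ S} → ZMod d × ZMod d,
      |∑ a, (conj (pauliTrace O (glue S (a, κ))) *
          pauliTrace ((-Complex.I) • (A * O - O * A)) (glue S (a, κ))).re *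
            Real.log (‖pauliTrace O (glue S (a, κ))‖ ^ 2)| ≤
      4 * (d : ℝ) ^ 2 * (Real.exp 1)⁻¹ * ∑ a, ‖pauliTrace O (glue S (a, κ))‖ ^ 2 := by
    intro κ
    simp only [← pauliTrace_partialPauliTrace, hcomm]
    refine (abs_sum_re_mul_log_le _ _ ?_ ?_).trans ?_
    · rw [← Complex.re_sum, sum_conj_pauliTrace_mul, ← Nat.cast_pow, ← Complex.ofReal_natCast,
        Complex.re_ofReal_mul, re_trace_conjTranspose_mul_commutator hBh, mul_zero]
    · rw [sum_norm_sq_pauliTrace, sum_norm_sq_pauliTrace, mul_left_comm]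
      exact mul_le_mul_of_nonneg_left
        (sum_norm_sq_commutator_le hBh (hB.sum_norm_sq_mulVec_le hn) _) (by positivity)
    · gcongr
  rw [← (glue S).sum_comp, ← (glue S).sum_comp (fun a => ‖pauliTrace O a‖ ^ 2),
    Fintype.sum_prod_type_right, Fintype.sum_prod_type_right, Finset.mul_sum]
  exact (Finset.abs_sum_le_sum_abs _ _).trans (Finset.sum_le_sum fun κ _ => hblock κ)

/-! ### Evolution of the entropy -/

section MatrixDeriv

variable {α : Type*} [Fintype α] {M N : ℝ → Matrix α α ℂ} {M' N' : Matrix α α ℂ}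
  {s : Set ℝ} {t : ℝ}

theorem hasDerivWithinAt_matrix_iff : HasDerivWithinAt M M' s t ↔
    ∀ i j, HasDerivWithinAt (fun u => M u i j) (M' i j) s t :=
  (hasDerivWithinAt_pi (φ := fun u i j => M u i j) (φ' := fun i j => M' i j)).trans
    (forall_congr' fun _ => hasDerivWithinAt_pi)

theorem hasDerivWithinAt_matrix_mul (hM : HasDerivWithinAt M M' s t)
    (hN : HasDerivWithinAt N N' s t) :
    HasDerivWithinAt (fun u => M u * N u) (M' * N t + M t * N') s t := by
  rw [hasDerivWithinAt_matrix_iff] at *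
  intro i j
  simp only [Matrix.mul_apply, Matrix.add_apply, ← Finset.sum_add_distrib]
  exact HasDerivWithinAt.fun_sum fun k _ => (hM i k).mul (hN k j)

theorem hasDerivWithinAt_conjTranspose (hM : HasDerivWithinAt M M' s t) :
    HasDerivWithinAt (fun u => (M u)ᴴ) M'ᴴ s t := by
  rw [hasDerivWithinAt_matrix_iff] at *
  exact fun i j => (hM j i).star

end MatrixDeriv

theorem hasDerivWithinAt_pauliTrace {O : ℝ → Op n d} {O' : Op n d} {s : Set ℝ} {t : ℝ}
    (hO : HasDerivWithinAt O O' s t) (a : Fin n → ZMod d × ZMod d) :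
    HasDerivWithinAt (fun u => pauliTrace (O u) a) (pauliTrace O' a) s t := by
  rw [hasDerivWithinAt_matrix_iff] at hO
  exact HasDerivWithinAt.fun_sum fun x _ => HasDerivWithinAt.fun_sum fun y _ =>
    (hO x y).mul_const _

theorem pauliTrace_sum_smul {κ : Type*} [Fintype κ] (c : κ → ℂ) (O : κ → Op n d)
    (a : Fin n → ZMod d × ZMod d) :
    pauliTrace (∑ j, c j • O j) a = ∑ j, c j * pauliTrace (O j) a := by
  simp only [pauliTrace, Matrix.sum_apply, Matrix.smul_apply, smul_eq_mul, Finset.sum_mul,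
    Finset.mul_sum, mul_assoc]
  symm
  rw [Finset.sum_comm]
  exact Finset.sum_congr rfl fun x _ => Finset.sum_comm

/-- The natural-logarithm entropy `-∑ a, x_a log x_a` of the weights `x_a = |Tr (O P_a)|²`. No factor
`d ^ (-2 n)` is included: it is absorbed by scaling `O`, see `fourierEntropy_eq_pauliEntropy`. -/
def pauliEntropy (O : Op n d) : ℝ := ∑ a, Real.negMulLog (‖pauliTrace O a‖ ^ 2)

section Propagator

variable {H V : ℝ → Op n d}

/-- The propagator of a Hermitian generator is unitary. -/
theorem conjTranspose_mul_propagator (hH : ∀ s, (H s).IsHermitian) (h0 : V 0 = 1)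
    (hV : ∀ s ∈ Icc (0 : ℝ) 1,
      HasDerivWithinAt V ((-Complex.I) • (H s * V s)) (Icc 0 1) s) {s : ℝ}
    (hs : s ∈ Icc (0 : ℝ) 1) : (V s)ᴴ * V s = 1 := by
  have hW : ∀ s ∈ Icc (0 : ℝ) 1, HasDerivWithinAt (fun u => (V u)ᴴ * V u) 0 (Icc 0 1) s := by
    intro s hs
    have h := hasDerivWithinAt_matrix_mul (hasDerivWithinAt_conjTranspose (hV s hs)) (hV s hs)
    convert h using 1
    symm
    rw [Matrix.conjTranspose_smul, Matrix.conjTranspose_mul, (hH s).eq, Matrix.smul_mul,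
      Matrix.mul_smul, Matrix.mul_assoc, ← add_smul]
    simp
  ext i j
  have h := constant_of_has_deriv_right_zero (f := fun u => ((V u)ᴴ * V u) i j) (a := 0) (b := 1)
    (fun u hu => (hasDerivWithinAt_matrix_iff.1 (hW u hu) i j).continuousWithinAt)
    (fun u hu => (hasDerivWithinAt_matrix_iff.1 (hW u ⟨hu.1, hu.2.le⟩) i j).mono_of_mem_nhdsWithin
      (Icc_mem_nhdsGE_of_mem hu)) s hs
  simpa [h0] using h

/-- The evolved operator `V O V†` obeys the Heisenberg-type equation `P' = -i [H, P]`. -/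
theorem hasDerivWithinAt_conj_propagator (hH : ∀ s, (H s).IsHermitian)
    (hV : ∀ s ∈ Icc (0 : ℝ) 1,
      HasDerivWithinAt V ((-Complex.I) • (H s * V s)) (Icc 0 1) s) (O : Op n d) {s : ℝ}
    (hs : s ∈ Icc (0 : ℝ) 1) :
    HasDerivWithinAt (fun u => V u * O * (V u)ᴴ)
      ((-Complex.I) • (H s * (V s * O * (V s)ᴴ) - V s * O * (V s)ᴴ * H s)) (Icc 0 1) s := by
  have h1 : HasDerivWithinAt (fun _ : ℝ => O) 0 (Icc 0 1) s :=
    hasDerivWithinAt_matrix_iff.2 fun i j => hasDerivWithinAt_const _ _ _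
  have h := hasDerivWithinAt_matrix_mul (hasDerivWithinAt_matrix_mul (hV s hs) h1)
    (hasDerivWithinAt_conjTranspose (hV s hs))
  convert h using 1
  symm
  rw [Matrix.conjTranspose_smul, Matrix.conjTranspose_mul, (hH s).eq, star_neg, Complex.star_def,
    Complex.conj_I, neg_neg, Matrix.mul_zero, add_zero]
  simp only [Matrix.smul_mul, Matrix.mul_smul, smul_sub, Matrix.mul_assoc, neg_smul, Matrix.neg_mul]
  abel

end Propagator

theorem sum_norm_sq_pauliTrace_conj {W : Op n d} (hW : Wᴴ * W = 1) (O : Op n d) :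
    ∑ a, ‖pauliTrace (W * O * Wᴴ) a‖ ^ 2 = ∑ a, ‖pauliTrace O a‖ ^ 2 := by
  have h : ∀ A : Op n d, ((∑ a, ‖pauliTrace A a‖ ^ 2 : ℝ) : ℂ) =
      (d : ℂ) ^ Fintype.card (Fin n) * (Aᴴ * A).trace := by
    intro A
    rw [← sum_conj_pauliTrace_mul]
    push_cast
    simp only [Complex.conj_mul']
  have h2 : ((W * O * Wᴴ)ᴴ * (W * O * Wᴴ)) = W * (Oᴴ * O) * Wᴴ := by
    rw [Matrix.conjTranspose_mul, Matrix.conjTranspose_mul, Matrix.conjTranspose_conjTranspose]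
    calc _ = W * Oᴴ * (Wᴴ * W) * O * Wᴴ := by simp only [Matrix.mul_assoc]
      _ = _ := by rw [hW, Matrix.mul_one]; simp only [Matrix.mul_assoc]
  have h3 := h (W * O * Wᴴ)
  rw [h2, Matrix.trace_mul_comm, ← Matrix.mul_assoc, hW, Matrix.one_mul, ← h O] at h3
  exact_mod_cast h3

/-- The entropy changes at rate at most `(8 d² / e) ∑ j, |r j|` along the evolution generated by
`∑ j, r j • h j`. -/
theorem abs_pauliEntropy_sub_le {m : ℕ} {h : Fin m → Op n d}
    (h_herm : ∀ j, (h j).IsHermitian)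
    (h_supp : ∀ j, ∃ S : Finset (Fin n), S.card ≤ 2 ∧ SupportedOn (h j) S)
    (h_norm : ∀ j, opNorm (h j) ≤ 1) {U : Op n d} {r : Fin m → ℝ → ℝ} (hr : IsControl h U r)
    {O : Op n d} (hO : ∑ a, ‖pauliTrace O a‖ ^ 2 = 1) :
    |pauliEntropy (U * O * Uᴴ) - pauliEntropy O| ≤
      8 * (d : ℝ) ^ 2 * (Real.exp 1)⁻¹ * ∫ s in (0 : ℝ)..1, ∑ j, |r j s| := by
  obtain ⟨hcont, V, hV0, hV1, hV⟩ := hr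
  set H : ℝ → Op n d := fun s => ∑ j, (r j s : ℂ) • h j with hHdef
  set C : ℝ := 8 * (d : ℝ) ^ 2 * (Real.exp 1)⁻¹ with hC
  have hH : ∀ s, (H s).IsHermitian := by
    intro s
    rw [Matrix.IsHermitian, hHdef, Matrix.conjTranspose_sum]
    refine Finset.sum_congr rfl fun j _ => ?_
    rw [Matrix.conjTranspose_smul, (h_herm j).eq, Complex.star_def, Complex.conj_ofReal]
  let P : ℝ → Op n d := fun s => V s * O * (V s)ᴴ
  let P' : ℝ → Op n d := fun s => (-Complex.I) • (H s * P s - P s * H s)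
  have hPn : ∀ s ∈ Icc (0 : ℝ) 1, ∑ a, ‖pauliTrace (P s) a‖ ^ 2 = 1 := fun s hs => by
    rw [sum_norm_sq_pauliTrace_conj (conjTranspose_mul_propagator hH hV0 hV hs), hO]
  let D : ℝ → ℝ := fun s => ∑ a, -(2 * (conj (pauliTrace (P s) a) * pauliTrace (P' s) a).re) *
    (Real.log (‖pauliTrace (P s) a‖ ^ 2) + 1)
  have hderiv : ∀ s ∈ Icc (0 : ℝ) 1,
      HasDerivWithinAt (fun u => pauliEntropy (P u)) (D s) (Icc 0 1) s := fun s hs =>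
    HasDerivWithinAt.fun_sum fun a _ => hasDerivWithinAt_negMulLog_norm_sq
      (hasDerivWithinAt_pauliTrace (hasDerivWithinAt_conj_propagator hH hV O hs) a)
  have hP' : ∀ s, P' s = ∑ j, (r j s : ℂ) • ((-Complex.I) • (h j * P s - P s * h j)) := by
    intro s
    simp only [P', hHdef, Finset.sum_mul, Finset.mul_sum, ← Finset.sum_sub_distrib,
      Finset.smul_sum, Matrix.smul_mul, Matrix.mul_smul, ← smul_sub]
    exact Finset.sum_congr rfl fun j _ => smul_comm _ _ _
  have hD : ∀ s ∈ Icc (0 : ℝ) 1, |D s| ≤ C * ∑ j, |r j s| := by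
    intro s hs
    have h1 : D s = -2 * ∑ j, r j s * ∑ a, (conj (pauliTrace (P s) a) *
        pauliTrace ((-Complex.I) • (h j * P s - P s * h j)) a).re *
          Real.log (‖pauliTrace (P s) a‖ ^ 2) := by
      -- The `+ 1` from differentiating `-x log x` drops out, since the total weight is conserved.
      have h2 := sum_re_conj_pauliTrace_commutator (hH s) (P s)
      calc D s = -2 * ∑ a, (conj (pauliTrace (P s) a) * pauliTrace (P' s) a).re *
              Real.log (‖pauliTrace (P s) a‖ ^ 2) -
            2 * ∑ a, (conj (pauliTrace (P s) a) * pauliTrace (P' s) a).re := by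
            simp only [D, Finset.mul_sum, ← Finset.sum_sub_distrib]
            exact Finset.sum_congr rfl fun a _ => by ring
        _ = -2 * ∑ a, (conj (pauliTrace (P s) a) * pauliTrace (P' s) a).re *
              Real.log (‖pauliTrace (P s) a‖ ^ 2) := by
            rw [show ∑ a, (conj (pauliTrace (P s) a) * pauliTrace (P' s) a).re = 0 from h2]
            ring
        _ = _ := by
            congr 1
            simp only [hP', pauliTrace_sum_smul, Finset.mul_sum, Complex.re_sum, Finset.sum_mul]
            rw [Finset.sum_comm]
            refine Finset.sum_congr rfl fun j _ => Finset.sum_congr rfl fun a _ => ?_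
            rw [mul_left_comm, Complex.re_ofReal_mul]
            ring
    rw [h1, abs_mul, abs_neg, abs_two]
    calc _ ≤ 2 * ∑ j, |r j s| * (4 * (d : ℝ) ^ 2 * (Real.exp 1)⁻¹) := by
          gcongr
          refine (Finset.abs_sum_le_sum_abs _ _).trans (Finset.sum_le_sum fun j _ => ?_)
          rw [abs_mul]
          obtain ⟨S, hS, hSupp⟩ := h_supp j
          have h3 := abs_sum_pauliTrace_commutator_mul_log_le (h_herm j) hS hSupp (h_norm j) (P s)
          rw [hPn s hs, mul_one] at h3
          gcongr
      _ = C * ∑ j, |r j s| := by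
          rw [← Finset.sum_mul, hC]
          ring
  have hgc : ContinuousOn (fun u => pauliEntropy (P u)) (Icc 0 1) :=
    fun s hs => (hderiv s hs).continuousWithinAt
  have hgd : ∀ s ∈ Ioo (0 : ℝ) 1,
      HasDerivWithinAt (fun u => pauliEntropy (P u)) (D s) (Ioi s) s := fun s hs =>
    ((hderiv s (Ioo_subset_Icc_self hs)).hasDerivAt (Icc_mem_nhds hs.1 hs.2)).hasDerivWithinAt
  have hint : MeasureTheory.IntegrableOn (fun s => C * ∑ j, |r j s|) (Icc 0 1) := by
    refine ContinuousOn.integrableOn_Icc ?_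
    exact continuousOn_const.mul (continuousOn_finsetSum _ fun j _ => (hcont j).abs)
  have hup := intervalIntegral.sub_le_integral_of_hasDeriv_right_of_le zero_le_one hgc hgd hint
    fun s hs => (le_abs_self _).trans (hD s (Ioo_subset_Icc_self hs))
  have hdown := intervalIntegral.sub_le_integral_of_hasDeriv_right_of_le zero_le_one hgc.neg
    (fun s hs => (hgd s hs).neg) hint
    fun s hs => (neg_le_abs _).trans (hD s (Ioo_subset_Icc_self hs))
  have hP0 : P 0 = O := by simp [P, hV0]
  have hP1 : P 1 = U * O * Uᴴ := by simp only [P, hV1]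
  rw [intervalIntegral.integral_const_mul] at hup hdown
  simp only [Pi.neg_apply, hP0, hP1] at hup hdown
  rw [abs_le]
  constructor <;> linarith

theorem pauliTrace_smul (c : ℂ) (O : Op n d) (a : Fin n → ZMod d × ZMod d) :
    pauliTrace (c • O) a = c * pauliTrace O a := by
  simpa using pauliTrace_sum_smul (fun _ : Unit => c) (fun _ => O) a

theorem pauliDist_eq_norm_sq_pauliTrace (O : Op n d) (a : Fin n → ZMod d × ZMod d) :
    pauliDist O a = ‖pauliTrace ((1 / (d : ℂ) ^ n) • O) a‖ ^ 2 := by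
  rw [pauliDist, trace_mul_pauli, pauliTrace_smul, norm_mul, mul_pow, norm_div, norm_pow, norm_one,
    Complex.norm_natCast, div_pow, one_pow, ← pow_mul, mul_comm 2 n]

theorem fourierEntropy_eq_pauliEntropy (O : Op n d) :
    fourierEntropy O = pauliEntropy ((1 / (d : ℂ) ^ n) • O) / Real.log 2 := by
  rw [fourierEntropy, pauliEntropy, Finset.sum_div, ← Finset.sum_neg_distrib]
  refine Finset.sum_congr rfl fun a _ => ?_
  rw [← pauliDist_eq_norm_sq_pauliTrace, Real.negMulLog, Real.logb]
  ring

theorem sum_norm_sq_pauliTrace_of_norm2_eq_one {O : Op n d} (hO : norm2 O = 1) :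
    ∑ a, ‖pauliTrace ((1 / (d : ℂ) ^ n) • O) a‖ ^ 2 = 1 := by
  have hd : (d : ℝ) ^ n ≠ 0 := pow_ne_zero _ (Nat.cast_ne_zero.2 (NeZero.ne d))
  have h := Real.sqrt_eq_one.1 (show √ (hsInner O O).re = 1 from hO)
  rw [hsInner_self_re] at h
  simp only [← pauliDist_eq_norm_sq_pauliTrace, pauliDist, trace_mul_pauli]
  rw [← Finset.mul_sum, sum_norm_sq_pauliTrace, Fintype.card_fin, ← mul_assoc]
  refine Eq.trans ?_ h
  congr 1
  rw [pow_mul']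
  field_simp

end QuditMagic
end

theorem theorem15 (n d m : ℕ) [NeZero d] (h : Fin m → QuditMagic.Op n d)
    (h_herm : ∀ j, (h j).IsHermitian) (h_trace : ∀ j, (h j).trace = 0)
    (h_supp : ∀ j, ∃ S : Finset (Fin n), S.card ≤ 2 ∧ QuditMagic.SupportedOn (h j) S)
    (h_norm : ∀ j, QuditMagic.opNorm (h j) = 1)
    (U : QuditMagic.Op n d) (hU : U ∈ Matrix.specialUnitaryGroup (Fin n → ZMod d) ℂ) :
    ((Real.exp 1 / (8 * (d : ℝ) ^ 2 * Real.logb 2 (Real.exp 1)) * QuditMagic.magicPower U : ℝ) :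
      EReal) ≤ QuditMagic.circuitCost h U := by
  refine le_iInf₂ fun r hr => EReal.coe_le_coe_iff.2 ?_
  -- An operator attaining the maximum; scaling it by `d ^ (-n)` turns `|Tr (O P_a)|²` into `P_O[a]`.
  obtain ⟨O, hO, hM⟩ := (QuditMagic.isGreatest_magicPower U).1
  have hb := QuditMagic.abs_pauliEntropy_sub_le h_herm h_supp (fun j => (h_norm j).le) hr
    (QuditMagic.sum_norm_sq_pauliTrace_of_norm2_eq_one hO)
  have hlog : 0 < Real.log 2 := Real.log_pos one_lt_two
  have hd : (0 : ℝ) < d := Nat.cast_pos.2 (NeZero.pos d)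
  rw [hM, QuditMagic.fourierEntropy_eq_pauliEntropy, QuditMagic.fourierEntropy_eq_pauliEntropy,
    ← sub_div, abs_div, abs_of_pos hlog, Real.logb, Real.log_exp, ← Matrix.smul_mul,
    ← Matrix.mul_smul]
  calc _ = Real.exp 1 / (8 * (d : ℝ) ^ 2) *
        |QuditMagic.pauliEntropy (U * ((1 / (d : ℂ) ^ n) • O) * U.conjTranspose) -
          QuditMagic.pauliEntropy ((1 / (d : ℂ) ^ n) • O)| := by field_simp
    _ ≤ Real.exp 1 / (8 * (d : ℝ) ^ 2) *
        (8 * (d : ℝ) ^ 2 * (Real.exp 1)⁻¹ * ∫ s in (0 : ℝ)..1, ∑ j, |r j s|) := by gcongr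
    _ = _ := by field_simp
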